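/- Let $\mathbb{P}\mathbf{SymmH}$ (the projective quantum symmetry groupoid) be the category whose objects are the complex Hilbert spaces of (possibly infinite) dimension greater than $2$ and whose morphisms $\mathcal H\to\mathcal K$ are semiunitary maps $U$ up to a phase. Here a semiunitary map is a bijective additive map $U$ with $U(\lambda\phi)=\sigma(\lambda)U\phi$ and $\langle U\phi, U\psi\rangle=\sigma(\langle\phi,\psi\rangle)$, where $\sigma$ is either the identity of $\mathbb{C}$ (unitary) or complex conjugation (antiunitary), and $U\sim V$ iff $U=\lambda V$ for some $\lambda\in\mathbb{C}$ with $|\lambda|=1$. A Chu space over a set $K$ is a triple $(X,A,e)$ with sets $X$, $A$ and a function $e:X\times A\to K$; a morphism $(X,A,e)\to(X',A',e')$ is a pair of functions $f_*:X\to X'$, $f^*:A'\to A$ with $e(x,f^*(a'))=e'(f_*(x),a')$ for all $x\in X$, $a'\in A'$, and morphisms compose componentwise. The space is biextensional if $e(x,a)=e(x,b)$ for all $x\in X$ implies $a=b$, and $e(x,a)=e(y,a)$ for all $a\in A$ implies $x=y$. Let $\mathbf{bmChu}_K$ be the category of biextensional Chu spaces over $K$ and those Chu morphisms $(f_*,f^*)$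 for which $f_*$ is injective. Let $\mathsf{P}R:\mathbb{P}\mathbf{SymmH}\to\mathbf{bmChu}_{[0,1]}$ be the functor that sends $\mathcal H$ to $(\mathsf P(\mathcal H),\mathsf L(\mathcal H),\bar e_{\mathcal H})$, where $\mathsf P(\mathcal H)$ is the set of rays (one-dimensional subspaces) $\bar\psi$ of $\mathcal H$, $\mathsf L(\mathcal H)$ is the set of closed subspaces of $\mathcal H$, and $\bar e_{\mathcal H}(\bar\psi,S)=\|P_S\psi\|^2/\|\psi\|^2$ with $P_S$ the orthogonal projection onto $S$, and that sends the class of $U$ to $(\mathsf P U,U^{-1})$, where $\mathsf PU(\bar\psi)=\overline{U\psi}$ and $U^{-1}$ is the inverse image map on closed subspaces. Let $v:[0,1]\to\mathbf 3=\{0,1,2\}$ send $0$ to $0$, $1$ to $1$ and every $t\in(0,1)$ to $2$, and let $F_v$ be the functor that sends $(X,A,e)$ to $(X,A,v\circ e)$ and leaves the pair of functions of a morphism unchanged. Then $F_v\circ\mathsf PR$ takes values in $\mathbf{bmChu}_{\mathbf 3}$, and the functor $F_v\circ\mathsf PR:\mathbb{P}\mathbf{SymmH}\to\mathbf{bmChu}_{\mathbf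 3}$ is full and faithful. -/

import Mathlib

open CategoryTheory
open scoped LinearAlgebra.Projectivization

universe u w w'

noncomputable section

namespace QuantumChu

/-! ## Chu spaces -/

/-- A Chu space over `K`: points, attributes, and an evaluation with values in `K`. -/
structure ChuSpace (K : Type w) where
  /-- The points. -/
  points : Type u
  /-- The attributes. -/
  attrs : Type u
  /-- The evaluation. -/
  eval : points → attrs → K

/-- A morphism of Chu spaces: a map on points and a map backwards on attributes that satisfy the
adjointness condition for the evaluations. -/
@[ext]
structure ChuHom {K : Type w} (X Y : ChuSpace.{u} K) where
  /-- The forward map `f_*` on points. -/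
  fwd : X.points → Y.points
  /-- The backward map `f^*` on attributes. -/
  bwd : Y.attrs → X.attrs
  /-- The Chu morphism condition. -/
  adj : ∀ (x : X.points) (a : Y.attrs), X.eval x (bwd a) = Y.eval (fwd x) a

/-- The category of Chu spaces over `K`. -/
instance (K : Type w) : Category (ChuSpace.{u} K) where
  Hom X Y := ChuHom X Y
  id X := ⟨id, id, fun _ _ => rfl⟩
  comp f g := ⟨g.fwd ∘ f.fwd, f.bwd ∘ g.bwd, fun x a =>
    (f.adj x (g.bwd a)).trans (g.adj (f.fwd x) a)⟩

/-- The functor given by post-composing the evaluation with `v : K → L`; it does not change the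
underlying functions of a morphism. -/
def changeValues {K : Type w} {L : Type w'} (v : K → L) :
    ChuSpace.{u} K ⥤ ChuSpace.{u} L where
  obj X := ⟨X.points, X.attrs, fun x a => v (X.eval x a)⟩
  map f := ⟨f.fwd, f.bwd, fun x a => congrArg v (f.adj x a)⟩

/-- Attributes with the same evaluation on all points are equal. -/
def ChuSpace.IsExtensional {K : Type w} (X : ChuSpace.{u} K) : Prop :=
  ∀ a b : X.attrs, (∀ x, X.eval x a = X.eval x b) → a = b

/-- Points with the same evaluation on all attributes are equal. -/
def ChuSpace.IsSeparated {K : Type w} (X : ChuSpace.{u} K) : Prop :=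
  ∀ x y : X.points, (∀ a, X.eval x a = X.eval y a) → x = y

/-- Extensional and separated. -/
def ChuSpace.IsBiextensional {K : Type w} (X : ChuSpace.{u} K) : Prop :=
  X.IsExtensional ∧ X.IsSeparated

/-- Objects of the category of biextensional Chu spaces over `K`, with those Chu morphisms whose
forward map is injective. -/
structure BmChu (K : Type w) where
  /-- The underlying Chu space. -/
  toChu : ChuSpace.{u} K
  /-- It is biextensional. -/
  biext : toChu.IsBiextensional

/-- Morphisms of `BmChu`: Chu morphisms with injective forward map. -/
@[ext]
structure BmChuHom {K : Type w} (X Y : BmChu.{u} K) where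
  /-- The underlying Chu morphism. -/
  hom : X.toChu ⟶ Y.toChu
  /-- Injectivity of the forward map. -/
  inj : Function.Injective hom.fwd

instance (K : Type w) : Category (BmChu.{u} K) where
  Hom X Y := BmChuHom X Y
  id X := ⟨𝟙 X.toChu, fun _ _ h => h⟩
  comp f g := ⟨f.hom ≫ g.hom, g.inj.comp f.inj⟩

/-- The inclusion of `BmChu K` into all Chu spaces over `K`. -/
def BmChu.incl (K : Type w) : BmChu.{u} K ⥤ ChuSpace.{u} K where
  obj X := X.toChu
  map f := f.hom

/-- A functor into Chu spaces whose values are biextensional, and that sends every morphism to one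
with injective forward map, regarded as a functor into `BmChu K`. -/
def BmChu.corestrict {C : Type*} [Category* C] {K : Type w} (F : C ⥤ ChuSpace.{u} K)
    (hobj : ∀ X, (F.obj X).IsBiextensional)
    (hmap : ∀ {X Y : C} (f : X ⟶ Y), Function.Injective (F.map f).fwd) : C ⥤ BmChu.{u} K where
  obj X := ⟨F.obj X, hobj X⟩
  map f := ⟨F.map f, hmap f⟩
  map_id X := BmChuHom.ext (F.map_id X)
  map_comp f g := BmChuHom.ext (F.map_comp f g)

/-! ## The quantum symmetry groupoid and its projective version -/

/-- Complex Hilbert spaces of dimension greater than two (possibly infinite-dimensional). -/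
structure SymmH where
  /-- The underlying type. -/
  carrier : Type u
  [normed : NormedAddCommGroup carrier]
  [inner : InnerProductSpace ℂ carrier]
  [complete : CompleteSpace carrier]
  /-- The dimension is greater than two. -/
  two_lt_rank : 2 < Module.rank ℂ carrier

attribute [instance] SymmH.normed SymmH.inner SymmH.complete

/-- Semiunitary maps: bijective additive maps that are, together with the inner product,
`σ`-semilinear, where `σ` is the identity (unitary) or complex conjugation (antiunitary). -/
@[ext]
structure Semiunitary (H K : SymmH.{u}) where
  /-- The underlying map. -/
  toFun : H.carrier → K.carrier
  bijective : Function.Bijective toFun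
  map_add : ∀ φ ψ, toFun (φ + ψ) = toFun φ + toFun ψ
  semi : ∃ σ : ℂ →+* ℂ, (σ = RingHom.id ℂ ∨ σ = starRingEnd ℂ) ∧
    (∀ (c : ℂ) ψ, toFun (c • ψ) = σ c • toFun ψ) ∧
    (∀ φ ψ, inner ℂ (toFun φ) (toFun ψ) = σ (inner ℂ φ ψ))

/-- The category of Hilbert spaces of dimension greater than two and semiunitary maps. -/
instance : Category SymmH.{u} where
  Hom H K := Semiunitary H K
  id H :=
    { toFun := id
      bijective := Function.bijective_id
      map_add := fun _ _ => rfl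
      semi := ⟨RingHom.id ℂ, Or.inl rfl, fun _ _ => rfl, fun _ _ => rfl⟩ }
  comp U V :=
    { toFun := V.toFun ∘ U.toFun
      bijective := V.bijective.comp U.bijective
      map_add := fun φ ψ => by simp [U.map_add, V.map_add]
      semi := by
        obtain ⟨σ, hσ, hs, hi⟩ := U.semi
        obtain ⟨τ, hτ, ht, hj⟩ := V.semi
        refine ⟨τ.comp σ, ?_, fun c ψ => by simp [hs, ht], fun φ ψ => by simp [hi, hj]⟩
        rcases hσ with rfl | rfl <;> rcases hτ with rfl | rfl
        · exact Or.inl rfl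
        · exact Or.inr rfl
        · exact Or.inr rfl
        · exact Or.inl (by ext x; simp) }

/-- Two semiunitaries are related when they differ by a phase. -/
def phaseRel : HomRel SymmH.{u} := fun H K (U V : Semiunitary H K) =>
  ∃ c : ℂ, ‖c‖ = 1 ∧ ∀ ψ, U.toFun ψ = c • V.toFun ψ

/-- The projective quantum symmetry groupoid: the quotient of `SymmH` by phases. -/
abbrev PSymmH : Type (u + 1) := CategoryTheory.Quotient phaseRel.{u}

/-- Differing by a phase is a congruence, so the quotient identifies nothing else. -/
instance : Congruence phaseRel.{u} where
  equivalence := by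
    intro H K
    refine ⟨fun U => ⟨1, by simp, fun ψ => by simp⟩, ?_, ?_⟩
    · rintro U V ⟨c, hc, h⟩
      have hc0 : c ≠ 0 := by rintro rfl; simp at hc
      exact ⟨c⁻¹, by simp [hc], fun ψ => by rw [h, smul_smul, inv_mul_cancel₀ hc0, one_smul]⟩
    · rintro U V W ⟨c, hc, h⟩ ⟨d, hd, k⟩
      exact ⟨c * d, by simp [hc, hd], fun ψ => by rw [h, k, smul_smul]⟩
  comp_left := by
    rintro H K L U V V' ⟨c, hc, h⟩
    exact ⟨c, hc, fun ψ => h _⟩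
  comp_right := by
    rintro H K L U U' V ⟨c, hc, h⟩
    obtain ⟨σ, hσ, hs, -⟩ := V.semi
    refine ⟨σ c, ?_, fun ψ => ?_⟩
    · rcases hσ with rfl | rfl <;> simpa using hc
    · exact (congrArg V.toFun (h ψ)).trans (hs _ _)

/-! ## The Chu space of rays and closed subspaces of a Hilbert space -/

section Ray

variable {E : Type u} [NormedAddCommGroup E] [InnerProductSpace ℂ E] [CompleteSpace E]

/-- The probability `‖P_S ψ‖² / ‖ψ‖²` of the answer yes to the question `S` in the state `ψ`. -/
def prob (ψ : {ψ : E // ψ ≠ 0}) (S : ClosedSubmodule ℂ E) : unitInterval :=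
  ⟨‖S.toSubmodule.starProjection ψ.1‖ ^ 2 / ‖ψ.1‖ ^ 2, by positivity, by
    apply div_le_one_of_le₀ _ (by positivity)
    gcongr
    exact S.toSubmodule.norm_starProjection_apply_le _⟩

theorem prob_eq_one_iff (ψ : {ψ : E // ψ ≠ 0}) (S : ClosedSubmodule ℂ E) :
    prob ψ S = 1 ↔ ψ.1 ∈ S := by
  have h0 : 0 < ‖ψ.1‖ := norm_pos_iff.mpr ψ.2
  rw [← Subtype.coe_inj, ← ClosedSubmodule.mem_toSubmodule_iff,
    Submodule.mem_iff_norm_starProjection]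
  change ‖S.toSubmodule.starProjection ψ.1‖ ^ 2 / ‖ψ.1‖ ^ 2 = 1 ↔ _
  rw [div_eq_one_iff_eq (by positivity), sq_eq_sq₀ (norm_nonneg _) (norm_nonneg _)]

/-- The same probability as a function of the ray of `ψ`. -/
def rayProb (p : ℙ ℂ E) (S : ClosedSubmodule ℂ E) : unitInterval :=
  Projectivization.lift (fun ψ => prob ψ S) (by
    intro φ ψ c h
    have hc : c ≠ 0 := by rintro rfl; exact φ.2 (by simpa using h)
    apply Subtype.ext
    have : 0 < ‖c‖ := norm_pos_iff.mpr hc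
    have : 0 < ‖ψ.1‖ := norm_pos_iff.mpr ψ.2
    simp only [prob, h, map_smul, norm_smul]
    field_simp) p

theorem rayProb_mk_eq_one_iff (ψ : E) (hψ : ψ ≠ 0) (S : ClosedSubmodule ℂ E) :
    rayProb (Projectivization.mk ℂ ψ hψ) S = 1 ↔ ψ ∈ S :=
  prob_eq_one_iff ⟨ψ, hψ⟩ S

/-- Changing the values by a map that takes its value at `1` only there keeps the Chu space
of rays biextensional. -/
theorem biextensional_of_one {L : Type w'} (v : unitInterval → L)
    (hv : ∀ t, v t = v 1 → t = 1) :
    (ChuSpace.mk (ℙ ℂ E) (ClosedSubmodule ℂ E) fun p S => v (rayProb p S)).IsBiextensional := by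
  have key : ∀ (p q : ℙ ℂ E) (S T : ClosedSubmodule ℂ E), v (rayProb p S) = v (rayProb q T) →
      rayProb p S = 1 → rayProb q T = 1 := by
    intro p q S T h h1
    exact hv _ (by rw [← h, h1])
  constructor
  · intro S T h
    refine SetLike.ext (A := ClosedSubmodule ℂ E) fun ψ => ?_
    by_cases hψ : ψ = 0
    · subst hψ
      exact ⟨fun _ => zero_mem T, fun _ => zero_mem S⟩
    · rw [← rayProb_mk_eq_one_iff ψ hψ, ← rayProb_mk_eq_one_iff ψ hψ]
      exact ⟨key _ _ _ _ (h _), key _ _ _ _ (h _).symm⟩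
  · intro p q h
    induction p using Projectivization.ind with | h φ hφ =>
    induction q using Projectivization.ind with | h ψ hψ =>
    let S : ClosedSubmodule ℂ E := ⟨ℂ ∙ ψ, Submodule.closed_of_finiteDimensional _⟩
    have h1 := key _ _ S S (h S).symm
      ((rayProb_mk_eq_one_iff ψ hψ S).2 (Submodule.mem_span_singleton_self ψ))
    obtain ⟨c, hc⟩ := Submodule.mem_span_singleton.1
      (show φ ∈ ℂ ∙ ψ from (rayProb_mk_eq_one_iff φ hφ S).1 h1)
    exact (Projectivization.mk_eq_mk_iff' ℂ φ ψ hφ hψ).2 ⟨c, hc⟩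

end Ray

namespace Semiunitary

variable {H K : SymmH.{u}} (U : Semiunitary H K)

theorem map_zero : U.toFun 0 = 0 := by
  have h := U.map_add 0 0
  simpa using h

theorem map_sub (φ ψ : H.carrier) : U.toFun (φ - ψ) = U.toFun φ - U.toFun ψ := by
  rw [eq_sub_iff_add_eq, ← U.map_add, sub_add_cancel]

theorem map_ne_zero {ψ : H.carrier} (h : ψ ≠ 0) : U.toFun ψ ≠ 0 := fun h0 =>
  h (U.bijective.1 (h0.trans U.map_zero.symm))

theorem norm_map (ψ : H.carrier) : ‖U.toFun ψ‖ = ‖ψ‖ := by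
  obtain ⟨σ, hσ, -, hi⟩ := U.semi
  have h := hi ψ ψ
  rw [inner_self_eq_norm_sq_to_K, inner_self_eq_norm_sq_to_K] at h
  have h' : ‖U.toFun ψ‖ ^ 2 = ‖ψ‖ ^ 2 := by
    apply Complex.ofReal_injective
    rcases hσ with rfl | rfl <;> simpa using h
  exact (sq_eq_sq₀ (norm_nonneg _) (norm_nonneg _)).1 h'

theorem continuous : Continuous U.toFun := by
  refine (Isometry.of_dist_eq fun φ ψ => ?_).continuous
  rw [dist_eq_norm, dist_eq_norm, ← U.map_sub, U.norm_map]

/-- The map on rays induced by a semiunitary. -/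
def mapRay (p : ℙ ℂ H.carrier) : ℙ ℂ K.carrier :=
  Projectivization.lift
    (fun ψ => Projectivization.mk ℂ (U.toFun ψ.1) (U.map_ne_zero ψ.2)) (by
      intro φ ψ c h
      obtain ⟨σ, -, hs, -⟩ := U.semi
      exact (Projectivization.mk_eq_mk_iff' ℂ _ _ _ _).2 ⟨σ c, by rw [h, hs]⟩) p

/-- The inverse image of a closed subspace under a semiunitary. -/
def preimage (S : ClosedSubmodule ℂ K.carrier) : ClosedSubmodule ℂ H.carrier where
  carrier := U.toFun ⁻¹' S
  zero_mem' := by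
    change U.toFun 0 ∈ S
    rw [U.map_zero]
    exact zero_mem S
  add_mem' := by
    intro φ ψ hφ hψ
    change U.toFun (φ + ψ) ∈ S
    rw [U.map_add]
    exact add_mem hφ hψ
  smul_mem' := by
    intro c ψ hψ
    obtain ⟨σ, -, hs, -⟩ := U.semi
    change U.toFun (c • ψ) ∈ S
    rw [hs]
    exact S.toSubmodule.smul_mem _ hψ
  isClosed' := S.isClosed.preimage U.continuous

theorem starProjection_map (S : ClosedSubmodule ℂ K.carrier) (ψ : H.carrier) :
    S.toSubmodule.starProjection (U.toFun ψ) =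
      U.toFun ((U.preimage S).toSubmodule.starProjection ψ) := by
  apply Submodule.eq_starProjection_of_mem_of_inner_eq_zero
  · exact Submodule.starProjection_apply_mem (U.preimage S).toSubmodule ψ
  · intro s hs
    obtain ⟨t, rfl⟩ := U.bijective.2 s
    obtain ⟨σ, -, -, hi⟩ := U.semi
    rw [← U.map_sub, hi, Submodule.starProjection_inner_eq_zero _ _
      (show t ∈ (U.preimage S).toSubmodule from hs), _root_.map_zero]

theorem rayProb_preimage (p : ℙ ℂ H.carrier) (S : ClosedSubmodule ℂ K.carrier) :
    rayProb p (U.preimage S) = rayProb (U.mapRay p) S := by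
  induction p using Projectivization.ind with | h ψ hψ =>
  apply Subtype.ext
  change ‖(U.preimage S).toSubmodule.starProjection ψ‖ ^ 2 / ‖ψ‖ ^ 2 =
    ‖S.toSubmodule.starProjection (U.toFun ψ)‖ ^ 2 / ‖U.toFun ψ‖ ^ 2
  rw [U.starProjection_map, U.norm_map, U.norm_map]

theorem mapRay_injective : Function.Injective U.mapRay := by
  intro p q h
  induction p using Projectivization.ind with | h φ hφ =>
  induction q using Projectivization.ind with | h ψ hψ =>
  obtain ⟨c, hc⟩ := (Projectivization.mk_eq_mk_iff' ℂ (U.toFun φ) (U.toFun ψ)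
    (U.map_ne_zero hφ) (U.map_ne_zero hψ)).1 h
  obtain ⟨σ, hσ, hs, -⟩ := U.semi
  refine (Projectivization.mk_eq_mk_iff' ℂ _ _ _ _).2 ⟨σ c, U.bijective.1 ?_⟩
  rw [hs, ← hc]
  rcases hσ with rfl | rfl <;> simp

end Semiunitary

/-- The functor from `SymmH` to Chu spaces over the unit interval that sends `H` to its rays, its
closed subspaces and their probabilities, and `U` to the map on rays and inverse image. -/
def rayChu : SymmH.{u} ⥤ ChuSpace.{u} unitInterval where
  obj H := ⟨ℙ ℂ H.carrier, ClosedSubmodule ℂ H.carrier, rayProb⟩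
  map {H K} (U : Semiunitary H K) := ⟨U.mapRay, U.preimage, U.rayProb_preimage⟩
  map_id H := by
    refine ChuHom.ext (funext fun p => ?_) rfl
    induction p using Projectivization.ind with | h φ hφ => rfl
  map_comp U V := by
    refine ChuHom.ext (funext fun p => ?_) rfl
    induction p using Projectivization.ind with | h φ hφ => rfl

theorem rayChu_map_eq {H K : SymmH.{u}} (U V : H ⟶ K) (h : phaseRel U V) :
    rayChu.map U = rayChu.map V := by
  obtain ⟨c, hc, h⟩ := h
  have hc0 : c ≠ 0 := by rintro rfl; simp at hc
  refine ChuHom.ext (funext fun p => ?_) (funext fun S => ?_)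
  · induction p using Projectivization.ind with | h φ hφ =>
    exact (Projectivization.mk_eq_mk_iff' ℂ _ _ _ _).2 ⟨c, (h φ).symm⟩
  · refine SetLike.ext (A := ClosedSubmodule ℂ H.carrier) fun ψ => ?_
    change Semiunitary.toFun U ψ ∈ S.toSubmodule ↔ Semiunitary.toFun V ψ ∈ S.toSubmodule
    rw [h ψ]
    exact S.toSubmodule.smul_mem_iff hc0

/-- The functor induced on the projective quantum symmetry groupoid, with values in biextensional
Chu spaces over `[0, 1]` and Chu morphisms with injective forward map. -/
def projRep : PSymmH.{u} ⥤ BmChu.{u} unitInterval :=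
  BmChu.corestrict (CategoryTheory.Quotient.lift phaseRel rayChu fun _ _ => rayChu_map_eq)
    (fun _ => biextensional_of_one id fun _ h => h)
    (fun f => by
      induction f using Quot.ind with | mk U =>
      exact Semiunitary.mapRay_injective U)

/-! ## Reduction to three values -/

/-- The map `[0, 1] → {0, 1, 2}` that sends `0` to `0`, `1` to `1`, and `(0, 1)` to `2`. -/
def threeValued (t : unitInterval) : Fin 3 :=
  if t = 0 then 0 else if t = 1 then 1 else 2

theorem threeValued_eq_one {t : unitInterval} (h : threeValued t = threeValued 1) : t = 1 := by
  by_contra h1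
  by_cases h0 : t = 0 <;> simp [threeValued, h0, h1] at h

/-- The composite of `projRep` with the change of values along `threeValued`; its values are again
biextensional. -/
def threeRep : PSymmH.{u} ⥤ BmChu.{u} (Fin 3) :=
  BmChu.corestrict (projRep ⋙ BmChu.incl unitInterval ⋙ changeValues threeValued)
    (fun _ => biextensional_of_one threeValued fun _ => threeValued_eq_one)
    (fun f => (projRep.map f).inj)

end QuantumChu

end

open scoped ComplexConjugate

noncomputable section

namespace QuantumChu

/-! ### Maps of inner product spaces that preserve the inner products 0 and -1. -/

section AffineChart

variable {A B : Type*} [NormedAddCommGroup A] [InnerProductSpace ℂ A]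
  [NormedAddCommGroup B] [InnerProductSpace ℂ B]

/-! Only the values 0 and 1 are needed: value 1 says that a ray lies in a closed subspace, value 0
that it is orthogonal to it.

Full: let `(f_*, f^*)` be a Chu morphism with `f_*` injective. By value 1, `f^*` sends the ray
`f_*(p)`, as a closed subspace, back to `p`; by value 0, `f_*` then preserves and reflects
orthogonality. It is also surjective (`surjective_of_adjoint`), so Uhlhorn's theorem applies. Its
proof here (`exists_semiunitary`) fixes unit vectors `e`, `e'` in corresponding rays and reads the
rays not orthogonal to `e` as an affine chart `e + x` with `x ⊥ e`. In the chart `f_*` is a map `T`,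
and orthogonality of rays reads `⟪x, y⟫ = -1`. As `T` also preserves `⟪x, y⟫ = 0` and `eᗮ` has
dimension at least two, `⟪T x, T y⟫` is a function `τ` of `⟪x, y⟫` alone. This forces `T` to be
additive and `τ` to be a field endomorphism commuting with conjugation, hence the identity or
conjugation. Sending `e` to `e'` extends `T` to a semiunitary. Finally `f^*` is determined by `f_*`.

Faithful: semiunitaries with the same ray map agree at each vector up to a scalar, and sums of
orthogonal vectors show that the scalar is constant. -/

theorem inner_self_ne_zero' {x : A} (hx : x ≠ 0) : inner ℂ x x ≠ 0 :=
  fun h => hx (inner_self_eq_zero.1 h)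

theorem exists_inner_eq {x : A} (hx : x ≠ 0) (c : ℂ) : ∃ y, inner ℂ x y = c :=
  ⟨(c / inner ℂ x x) • x, by
    rw [inner_smul_right, div_mul_cancel₀ _ (inner_self_ne_zero' hx)]⟩

theorem exists_inner_eq_inner_eq {x z : A} (hx : x ≠ 0) (hz : z ≠ 0) (h : inner ℂ x z = 0)
    (c d : ℂ) : ∃ y, inner ℂ x y = c ∧ inner ℂ z y = d := by
  have h' : inner ℂ z x = 0 := inner_eq_zero_symm.1 h
  refine ⟨(c / inner ℂ x x) • x + (d / inner ℂ z z) • z, ?_, ?_⟩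
  · rw [inner_add_right, inner_smul_right, inner_smul_right, h,
      div_mul_cancel₀ _ (inner_self_ne_zero' hx), mul_zero, add_zero]
  · rw [inner_add_right, inner_smul_right, inner_smul_right, h',
      div_mul_cancel₀ _ (inner_self_ne_zero' hz), mul_zero, zero_add]

/-- Every vector is a multiple of a given one plus a vector orthogonal to it. -/
theorem exists_eq_smul_add {x : A} (hx : x ≠ 0) (y : A) :
    ∃ (a : ℂ) (z : A), y = a • x + z ∧ inner ℂ x z = 0 :=
  ⟨inner ℂ x y / inner ℂ x x, y - (inner ℂ x y / inner ℂ x x) • x, by abel, by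
    rw [inner_sub_right, inner_smul_right, div_mul_cancel₀ _ (inner_self_ne_zero' hx), sub_self]⟩

/-- A surjection that preserves orthogonality maps multiples to multiples. -/
theorem exists_map_smul_eq {T : A → B} (hT : Function.Surjective T)
    (h0 : ∀ x y, inner ℂ x y = 0 ↔ inner ℂ (T x) (T y) = 0) (c : ℂ) {x : A} (hx : x ≠ 0) :
    ∃ s : ℂ, T (c • x) = s • T x := by
  have hTx : T x ≠ 0 := fun h => inner_self_ne_zero' hx ((h0 x x).2 (by simp [h]))
  obtain ⟨a, z, hz, ho⟩ := exists_eq_smul_add hTx (T (c • x))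
  obtain ⟨d, rfl⟩ := hT z
  have h1 : inner ℂ (T d) (T x) = 0 := inner_eq_zero_symm.1 ho
  have h2 : inner ℂ (T d) (T (c • x)) = 0 :=
    (h0 _ _).1 (by rw [inner_smul_right, (h0 _ _).2 h1, mul_zero])
  rw [hz, inner_add_right, inner_smul_right, h1, mul_zero, zero_add] at h2
  exact ⟨a, by rw [hz, inner_self_eq_zero.1 h2, add_zero]⟩

/-- A nonzero value can be normalised to -1 by rescaling `x`, and `T (c • x)` is a multiple of `T x`
that does not depend on `y`. -/
theorem inner_map_congr_right {T : A → B} (hT : Function.Surjective T)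
    (h0 : ∀ x y, inner ℂ x y = 0 ↔ inner ℂ (T x) (T y) = 0)
    (h1 : ∀ x y, inner ℂ x y = -1 → inner ℂ (T x) (T y) = -1) {x y y' : A}
    (h : inner ℂ x y = inner ℂ x y') : inner ℂ (T x) (T y) = inner ℂ (T x) (T y') := by
  by_cases hc : inner ℂ x y = 0
  · rw [(h0 _ _).1 hc, (h0 _ _).1 (h ▸ hc)]
  have hx : x ≠ 0 := fun hx => hc (by simp [hx])
  -- The inner product is conjugate-linear on the left, so this `c` gives `⟪c • x, y⟫ = -1`.
  set c : ℂ := conj (-(inner ℂ x y)⁻¹) with hcdef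
  obtain ⟨s, hs⟩ := exists_map_smul_eq hT h0 c hx
  have e1 := h1 (c • x) y (by rw [inner_smul_left, hcdef, Complex.conj_conj]; field_simp)
  have e2 := h1 (c • x) y' (by rw [inner_smul_left, hcdef, Complex.conj_conj, ← h]; field_simp)
  rw [hs, inner_smul_left] at e1 e2
  have hs0 : conj s ≠ 0 := fun hs0 => by simp [hs0] at e1
  exact mul_left_cancel₀ hs0 (e1.trans e2.symm)

/-- Pairs with equal inner product are joined by changing one vector at a time: `(x, y)`, `(x, w)`,
`(x', w)`, `(x', y')`, where `w` has the common inner product with both `x` and `x'`. -/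
theorem inner_map_congr {T : A → B} (hA : ∀ x : A, ∃ y ≠ 0, inner ℂ x y = 0)
    (hT : Function.Surjective T)
    (h0 : ∀ x y, inner ℂ x y = 0 ↔ inner ℂ (T x) (T y) = 0)
    (h1 : ∀ x y, inner ℂ x y = -1 → inner ℂ (T x) (T y) = -1) {x y x' y' : A}
    (h : inner ℂ x y = inner ℂ x' y') : inner ℂ (T x) (T y) = inner ℂ (T x') (T y') := by
  have hr : ∀ {x y y' : A}, inner ℂ x y = inner ℂ x y' →
      inner ℂ (T x) (T y) = inner ℂ (T x) (T y') := inner_map_congr_right hT h0 h1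
  have hl : ∀ {x x' y : A}, inner ℂ x y = inner ℂ x' y →
      inner ℂ (T x) (T y) = inner ℂ (T x') (T y) := by
    intro x x' y h
    rw [← inner_conj_symm, ← inner_conj_symm (T x')]
    rw [← inner_conj_symm, ← inner_conj_symm x'] at h
    rw [hr ((starRingEnd ℂ).injective h)]
  -- the case where the first vectors are independent
  have key : ∀ {x z : A} (a : ℂ), x ≠ 0 → z ≠ 0 → inner ℂ x z = 0 → ∀ {y y' : A},
      inner ℂ x y = inner ℂ (a • x + z) y' →
      inner ℂ (T x) (T y) = inner ℂ (T (a • x + z)) (T y') := by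
    intro x z a hx hz ho y y' h
    obtain ⟨w, hw1, hw2⟩ := exists_inner_eq_inner_eq hx hz ho (inner ℂ x y)
      (inner ℂ x y - conj a * inner ℂ x y)
    have e : inner ℂ (a • x + z) w = inner ℂ x y := by
      rw [inner_add_left, inner_smul_left, hw1, hw2]; ring
    rw [hr hw1.symm, hl (hw1.trans e.symm), hr (e.trans h)]
  by_cases hc : inner ℂ x y = 0
  · rw [(h0 _ _).1 hc, (h0 _ _).1 (h ▸ hc)]
  have hx : x ≠ 0 := fun hx => hc (by simp [hx])
  have hx' : x' ≠ 0 := fun hx' => hc (by simp [h, hx'])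
  obtain ⟨a, z, rfl, ho⟩ := exists_eq_smul_add hx x'
  by_cases hz : z = 0
  -- If `x'` is a multiple of `x`, no such `w` need exist; the detour is through a vector `v`
  -- orthogonal to both.
  · subst hz
    obtain ⟨v, hv, hxv⟩ := hA x
    obtain ⟨w, hw⟩ := exists_inner_eq hv (inner ℂ x y)
    have e1 := key 0 hx hv hxv (y := y) (y' := w) (by rw [zero_smul, zero_add, hw])
    have e2 := key 0 hx' hv (by simp [hxv]) (y := y') (y' := w)
      (by rw [zero_smul, zero_add, hw, h])
    rw [e1, e2]; simp
  · exact key a hx hz ho h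

/-- A surjection between complex inner product spaces, of dimension at least two, that preserves
the relations `⟪x, y⟫ = 0` and `⟪x, y⟫ = -1` is unitary or antiunitary. -/
theorem exists_semilinear_of_inner_eq_neg_one {T : A → B}
    (hA : ∀ x : A, ∃ y ≠ 0, inner ℂ x y = 0) (hT : Function.Surjective T)
    (h0 : ∀ x y, inner ℂ x y = 0 ↔ inner ℂ (T x) (T y) = 0)
    (h1 : ∀ x y, inner ℂ x y = -1 → inner ℂ (T x) (T y) = -1) :
    ∃ σ : ℂ →+* ℂ, (σ = RingHom.id ℂ ∨ σ = starRingEnd ℂ) ∧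
      (∀ x y, T (x + y) = T x + T y) ∧ (∀ (c : ℂ) x, T (c • x) = σ c • T x) ∧
      ∀ x y, inner ℂ (T x) (T y) = σ (inner ℂ x y) := by
  obtain ⟨u, hu, -⟩ := hA 0
  obtain ⟨v, hv, huv⟩ := hA u
  choose m hm using exists_inner_eq hu
  obtain ⟨τ, hτ⟩ : ∃ τ : ℂ → ℂ, ∀ x y, inner ℂ (T x) (T y) = τ (inner ℂ x y) :=
    ⟨fun c => inner ℂ (T u) (T (m c)), fun x y => inner_map_congr hA hT h0 h1 (hm _).symm⟩
  have τ_neg_one : τ (-1) = -1 := by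
    have h := hτ u (m (-1))
    rwa [hm, h1 _ _ (hm _), eq_comm] at h
  have τ_zero : τ 0 = 0 := by
    have h := hτ u (m 0)
    rwa [hm, (h0 _ _).1 (hm _), eq_comm] at h
  have τ_conj : ∀ c, τ (conj c) = conj (τ c) := by
    intro c
    rw [← hm c, inner_conj_symm, ← hτ, ← hτ, inner_conj_symm]
  have add_orth : ∀ x y, inner ℂ x y = 0 → T (x + y) = T x + T y := by
    intro x y h
    have h' : inner ℂ y x = 0 := inner_eq_zero_symm.1 h
    -- The defect of additivity is orthogonal to `T x`, `T y` and `T (x + y)`, hence to itself.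
    -- Orthogonality of `x` and `y` avoids additivity of `τ`, which is deduced from this case.
    obtain ⟨d, hd⟩ := hT (T (x + y) - (T x + T y))
    have dx : inner ℂ (T d) (T x) = 0 := by
      rw [hd, inner_sub_left, inner_add_left, hτ, hτ, hτ, inner_add_left, h', τ_zero, add_zero,
        add_zero, sub_self]
    have dy : inner ℂ (T d) (T y) = 0 := by
      rw [hd, inner_sub_left, inner_add_left, hτ, hτ, hτ, inner_add_left, h, τ_zero, zero_add,
        zero_add, sub_self]
    have dxy : inner ℂ (T d) (T (x + y)) = 0 := by
      rw [← h0, inner_add_right, (h0 _ _).2 dx, (h0 _ _).2 dy, add_zero]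
    have : inner ℂ (T d) (T d) = 0 := by
      nth_rewrite 2 [hd]
      rw [inner_sub_right, inner_add_right, dx, dy, dxy, add_zero, sub_zero]
    rw [inner_self_eq_zero.1 this] at hd
    exact sub_eq_zero.1 hd.symm
  have τ_add : ∀ c d, τ (c + d) = τ c + τ d := by
    intro c d
    obtain ⟨z, hz1, hz2⟩ := exists_inner_eq_inner_eq hu hv huv (conj c) (conj d)
    have e1 : inner ℂ z u = c := by rw [← inner_conj_symm, hz1, Complex.conj_conj]
    have e2 : inner ℂ z v = d := by rw [← inner_conj_symm, hz2, Complex.conj_conj]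
    rw [← e1, ← e2, ← inner_add_right, ← hτ, ← hτ, ← hτ, add_orth u v huv, inner_add_right]
  have T_add : ∀ x y, T (x + y) = T x + T y := by
    intro x y
    obtain ⟨d, hd⟩ := hT (T (x + y) - (T x + T y))
    have : inner ℂ (T d) (T d) = 0 := by
      nth_rewrite 2 [hd]
      rw [inner_sub_right, inner_add_right, hτ, hτ, hτ, inner_add_right, τ_add, sub_self]
    rw [inner_self_eq_zero.1 this] at hd
    exact sub_eq_zero.1 hd.symm
  have τ_neg : ∀ c, τ (-c) = -τ c := by
    intro c
    rw [eq_neg_iff_add_eq_zero, ← τ_add, neg_add_cancel, τ_zero]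
  have τ_one : τ 1 = 1 := by rw [← neg_neg (τ 1), ← τ_neg, τ_neg_one, neg_neg]
  have T_zero : T 0 = 0 := by simpa using T_add 0 0
  have T_smul : ∀ (c : ℂ) x, T (c • x) = τ c • T x := by
    intro c x
    by_cases hx : x = 0
    · simp [hx, T_zero]
    obtain ⟨s, hs⟩ := exists_map_smul_eq hT h0 c hx
    obtain ⟨z, hz⟩ := exists_inner_eq hx 1
    have hz' : inner ℂ z x = 1 := by rw [← inner_conj_symm, hz, map_one]
    have e : inner ℂ (T z) (T (c • x)) = τ c := by rw [hτ, inner_smul_right, hz', mul_one]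
    rw [hs, inner_smul_right, hτ, hz', τ_one, mul_one] at e
    rw [hs, e]
  let σ : ℂ →+* ℂ :=
    { toFun := τ
      map_one' := τ_one
      map_mul' := fun c d => by
        rw [← hm d, ← inner_smul_right, ← hτ, T_smul, inner_smul_right, hτ]
      map_zero' := τ_zero
      map_add' := τ_add }
  refine ⟨σ, ?_, T_add, T_smul, hτ⟩
  -- Commuting with conjugation, `σ` maps the reals to themselves, and `ℝ` has no ring endomorphism
  -- but the identity.
  have real : ∀ r : ℝ, σ r = r := by
    have im0 : ∀ r : ℝ, (σ r).im = 0 := fun r => by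
      have := τ_conj r
      rw [Complex.conj_ofReal] at this
      exact Complex.conj_eq_iff_im.1 this.symm
    let ρ : ℝ →+* ℝ :=
      { toFun := fun r => (σ r).re
        map_one' := by simp
        map_mul' := fun r s => by simp [im0]
        map_zero' := by simp
        map_add' := fun r s => by simp }
    intro r
    have : ρ r = r := by rw [Subsingleton.elim ρ (RingHom.id ℝ)]; rfl
    exact Complex.ext this (by simpa using im0 r)
  let σ' : ℂ →ₐ[ℝ] ℂ := { σ with commutes' := real }
  rcases Complex.real_algHom_eq_id_or_conj σ' with h | h
  · exact Or.inl (RingHom.ext fun c => DFunLike.congr_fun h c)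
  · exact Or.inr (RingHom.ext fun c => DFunLike.congr_fun h c)

end AffineChart

/-! ### Uhlhorn's theorem, for correspondences of nonzero vectors. -/

section OrthoCorrespondence

theorem inner_inv_norm_smul_self {V : Type*} [NormedAddCommGroup V] [InnerProductSpace ℂ V]
    {v : V} (hv : v ≠ 0) : inner ℂ ((‖v‖ : ℂ)⁻¹ • v) ((‖v‖ : ℂ)⁻¹ • v) = (1 : ℂ) := by
  have h : ‖(‖v‖ : ℂ)⁻¹ • v‖ = 1 := norm_smul_inv_norm (𝕜 := ℂ) hv
  rw [inner_self_eq_norm_sq_to_K, h]; simp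

theorem inner_smul_add_smul_add {V : Type*} [NormedAddCommGroup V] [InnerProductSpace ℂ V]
    {v x y : V} (c d : ℂ) (hv : inner ℂ v v = (1 : ℂ)) (hx : inner ℂ v x = (0 : ℂ))
    (hy : inner ℂ v y = (0 : ℂ)) :
    inner ℂ (c • v + x) (d • v + y) = conj c * d + inner ℂ x y := by
  rw [inner_add_left, inner_add_right, inner_add_right, inner_smul_left, inner_smul_right,
    inner_smul_left, inner_smul_right, hv, hy, inner_eq_zero_symm.1 hx]
  ring

variable {E F : Type*} [NormedAddCommGroup E] [InnerProductSpace ℂ E]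
  [NormedAddCommGroup F] [InnerProductSpace ℂ F]

/-- A correspondence between the nonzero vectors of two complex inner product spaces that is
total, surjective, invariant under rescaling, and preserves orthogonality. -/
structure OrthoCorrespondence (R : E → F → Prop) : Prop where
  ne_zero : ∀ {x x'}, R x x' → x' ≠ 0
  total : ∀ {x}, x ≠ 0 → ∃ x', R x x'
  surj : ∀ {x'}, x' ≠ 0 → ∃ x, R x x'
  smul : ∀ {x x'} {a b : ℂ}, R x x' → a ≠ 0 → b ≠ 0 → R (a • x) (b • x')
  inner_eq_zero_iff : ∀ {x x' y y'}, R x x' → R y y' → (inner ℂ x y = 0 ↔ inner ℂ x' y' = 0)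

namespace OrthoCorrespondence

variable {R : E → F → Prop}

/-- The vectors that correspond to a given vector are proportional. -/
theorem eq_smul (hR : OrthoCorrespondence R) {x : E} {x' x'' : F} (h : R x x') (h' : R x x'') : ∃ a : ℂ, x'' = a • x' := by
  obtain ⟨a, D, hD, ho⟩ := exists_eq_smul_add (hR.ne_zero h) x''
  by_cases hD0 : D = 0
  · exact ⟨a, by rw [hD, hD0, add_zero]⟩
  -- A vector `d` corresponding to the residue `D` is orthogonal to `x`, since `D ⊥ x'`; hence `D ⊥
  -- x''`, which forces `D = 0`.
  obtain ⟨d, hd⟩ := hR.surj hD0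
  have h1 := (hR.inner_eq_zero_iff hd h').1
    ((hR.inner_eq_zero_iff hd h).2 (inner_eq_zero_symm.1 ho))
  rw [hD, inner_add_right, inner_smul_right, inner_eq_zero_symm.1 ho, mul_zero, zero_add] at h1
  exact absurd (inner_self_eq_zero.1 h1) hD0

/-- A vector orthogonal to `e` corresponds to its image in the affine chart given by `e`. -/
theorem of_add (hR : OrthoCorrespondence R) {e x : E} {e' t : F} (he : R e e') (hx : x ≠ 0) (ht : t ≠ 0)
    (hex : inner ℂ e x = 0) (het : inner ℂ e' t = 0) (h : R (e + x) (e' + t)) : R x t := by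
  obtain ⟨x', hx'⟩ := hR.total hx
  obtain ⟨a, D, hD, ho⟩ := exists_eq_smul_add ht x'
  have ho' := inner_eq_zero_symm.1 ho
  have hD0 : D = 0 := by
    by_contra hD0
    obtain ⟨d, hd⟩ := hR.surj hD0
    -- `D` is orthogonal to `e'` and `e' + t`, so `d` is orthogonal to `e` and `e + x`, hence to
    -- `x`; thus `D ⊥ x'`.
    have e1 : inner ℂ D e' = 0 := by
      have h1 := (hR.inner_eq_zero_iff he hx').1 hex
      rw [hD, inner_add_right, inner_smul_right, het, mul_zero, zero_add] at h1
      exact inner_eq_zero_symm.1 h1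
    have e2 := (hR.inner_eq_zero_iff hd he).2 e1
    have e3 := (hR.inner_eq_zero_iff hd h).2 (by rw [inner_add_right, e1, ho', add_zero])
    rw [inner_add_right, e2, zero_add] at e3
    have e4 := (hR.inner_eq_zero_iff hd hx').1 e3
    rw [hD, inner_add_right, inner_smul_right, ho', mul_zero, zero_add] at e4
    exact hD0 (inner_self_eq_zero.1 e4)
  have ha : a ≠ 0 := fun ha => hR.ne_zero hx' (by rw [hD, hD0, ha]; simp)
  have := hR.smul hx' one_ne_zero (inv_ne_zero ha)
  rwa [one_smul, hD, hD0, add_zero, smul_smul, inv_mul_cancel₀ ha, one_smul] at this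

/-- Uhlhorn's theorem: in dimension greater than two, a correspondence of rays that preserves
orthogonality is given by a unitary or antiunitary map. -/
theorem exists_semiunitary (hR : OrthoCorrespondence R)
    (hE : ∀ x y : E, ∃ z ≠ 0, inner ℂ x z = 0 ∧ inner ℂ y z = 0) :
    ∃ (U : E → F) (σ : ℂ →+* ℂ), (σ = RingHom.id ℂ ∨ σ = starRingEnd ℂ) ∧
      Function.Bijective U ∧ (∀ x y, U (x + y) = U x + U y) ∧ (∀ (c : ℂ) x, U (c • x) = σ c • U x) ∧
      (∀ x y, inner ℂ (U x) (U y) = σ (inner ℂ x y)) ∧ ∀ x, x ≠ 0 → R x (U x) := by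
  obtain ⟨e, e', he, hee, hee'⟩ : ∃ e e', R e e' ∧ inner ℂ e e = 1 ∧ inner ℂ e' e' = 1 := by
    obtain ⟨x, hx, -⟩ := hE 0 0
    obtain ⟨x', hx'⟩ := hR.total hx
    have hx'0 := hR.ne_zero hx'
    exact ⟨_, _, hR.smul hx' (inv_ne_zero (by simpa using hx)) (inv_ne_zero (by simpa using hx'0)),
      inner_inv_norm_smul_self hx, inner_inv_norm_smul_self hx'0⟩
  have mem : ∀ x : (ℂ ∙ e)ᗮ, inner ℂ e (x : E) = 0 := fun x =>
    Submodule.mem_orthogonal_singleton_iff_inner_right.1 x.2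
  have mem' : ∀ x : (ℂ ∙ e')ᗮ, inner ℂ e' (x : F) = 0 := fun x =>
    Submodule.mem_orthogonal_singleton_iff_inner_right.1 x.2
  -- Vectors not orthogonal to `e` correspond to vectors not orthogonal to `e'`, whose
  -- `e'`-coordinate can be scaled to 1.
  have chart : ∀ x : (ℂ ∙ e)ᗮ, ∃ t : (ℂ ∙ e')ᗮ, R (e + x) (e' + t) := by
    intro x
    have h1 : inner ℂ e (e + x) = 1 := by rw [inner_add_right, mem, hee, add_zero]
    obtain ⟨y, hy⟩ := hR.total (x := e + x) (by intro h; simp [h] at h1)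
    have h2 : inner ℂ e' y ≠ 0 := fun h => by
      rw [(hR.inner_eq_zero_iff he hy).2 h] at h1
      exact zero_ne_one h1
    refine ⟨⟨(inner ℂ e' y)⁻¹ • y - e', ?_⟩, ?_⟩
    · rw [Submodule.mem_orthogonal_singleton_iff_inner_right, inner_sub_right, inner_smul_right,
        inv_mul_cancel₀ h2, hee', sub_self]
    · have := hR.smul hy one_ne_zero (inv_ne_zero h2)
      rw [one_smul] at this
      simpa using this
  choose T hTR using chart
  have uniq : ∀ (x : (ℂ ∙ e)ᗮ) (t : (ℂ ∙ e')ᗮ), R (e + x) (e' + t) → T x = t := by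
    intro x t h
    obtain ⟨a, ha⟩ := hR.eq_smul (hTR x) h
    have h1 : a = 1 := by
      have h2 := congrArg (inner ℂ e') ha
      rw [inner_smul_right, inner_add_right, inner_add_right, mem', mem', hee'] at h2
      simpa using h2.symm
    rw [h1, one_smul] at ha
    exact Subtype.ext (add_left_cancel ha.symm)
  have T_surj : Function.Surjective T := by
    intro t
    have h1 : inner ℂ e' (e' + t) = 1 := by rw [inner_add_right, mem', hee', add_zero]
    obtain ⟨p, hp⟩ := hR.surj (x' := e' + t) (by intro h; simp [h] at h1)
    have h2 : inner ℂ e p ≠ 0 := fun h => by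
      rw [(hR.inner_eq_zero_iff he hp).1 h] at h1
      exact zero_ne_one h1
    refine ⟨⟨(inner ℂ e p)⁻¹ • p - e, ?_⟩, uniq _ _ ?_⟩
    · rw [Submodule.mem_orthogonal_singleton_iff_inner_right, inner_sub_right, inner_smul_right,
        inv_mul_cancel₀ h2, hee, sub_self]
    · have := hR.smul hp (inv_ne_zero h2) one_ne_zero
      rw [one_smul] at this
      simpa using this
  have T_neg_one : ∀ x y, inner ℂ x y = -1 ↔ inner ℂ (T x) (T y) = -1 := by
    intro x y
    have h := hR.inner_eq_zero_iff (hTR x) (hTR y)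
    have e1 : inner ℂ (e + x) (e + y) = 1 + inner ℂ x y := by
      simpa using inner_smul_add_smul_add 1 1 hee (mem x) (mem y)
    have e2 : inner ℂ (e' + T x) (e' + T y) = 1 + inner ℂ (T x) (T y) := by
      simpa using inner_smul_add_smul_add 1 1 hee' (mem' (T x)) (mem' (T y))
    rw [e1, e2, add_comm, add_comm (1 : ℂ), ← eq_neg_iff_add_eq_zero,
      ← eq_neg_iff_add_eq_zero] at h
    exact h
  have T_zero : T 0 = 0 := uniq 0 0 (by simpa using he)
  have T_ne_zero : ∀ x, x ≠ 0 → T x ≠ 0 := by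
    intro x hx h
    obtain ⟨y, hy⟩ := exists_inner_eq hx (-1)
    have := (T_neg_one x y).1 hy
    simp [h] at this
  -- The chart map also describes the correspondence at infinity, on `eᗮ` itself; this yields
  -- preservation of `⟪x, y⟫ = 0`.
  have R_T : ∀ x : (ℂ ∙ e)ᗮ, x ≠ 0 → R (x : E) (T x : F) := fun x hx =>
    hR.of_add he (by simpa using hx) (by simpa using T_ne_zero x hx) (mem x) (mem' _) (hTR x)
  have T_orth : ∀ x y, inner ℂ x y = 0 ↔ inner ℂ (T x) (T y) = 0 := by
    intro x y
    by_cases hx : x = 0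
    · simp [hx, T_zero]
    by_cases hy : y = 0
    · simp [hy, T_zero]
    exact hR.inner_eq_zero_iff (R_T x hx) (R_T y hy)
  obtain ⟨σ, hσ, T_add, T_smul, T_inner⟩ := exists_semilinear_of_inner_eq_neg_one
    (fun x => by
      obtain ⟨z, hz, hez, hxz⟩ := hE e x
      exact ⟨⟨z, Submodule.mem_orthogonal_singleton_iff_inner_right.2 hez⟩, by simpa using hz, hxz⟩)
    T_surj T_orth (fun x y => (T_neg_one x y).1)
  have σσ : ∀ c, σ (σ c) = c := by rcases hσ with rfl | rfl <;> simp
  have σ_conj : ∀ c, σ (conj c) = conj (σ c) := by rcases hσ with rfl | rfl <;> simp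
  let P : E → (ℂ ∙ e)ᗮ := fun h => ⟨h - inner ℂ e h • e, by
    rw [Submodule.mem_orthogonal_singleton_iff_inner_right, inner_sub_right, inner_smul_right, hee,
      mul_one, sub_self]⟩
  have P_spec : ∀ h, h = inner ℂ e h • e + (P h : E) := fun h => (add_sub_cancel _ h).symm
  have P_add : ∀ x y, P (x + y) = P x + P y := by
    intro x y
    apply Subtype.ext
    change x + y - inner ℂ e (x + y) • e = x - inner ℂ e x • e + (y - inner ℂ e y • e)
    rw [inner_add_right, add_smul]; abel
  have P_smul : ∀ (c : ℂ) x, P (c • x) = c • P x := by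
    intro c x
    apply Subtype.ext
    change c • x - inner ℂ e (c • x) • e = c • (x - inner ℂ e x • e)
    rw [inner_smul_right, smul_sub, smul_smul]
  let U : E → F := fun h => σ (inner ℂ e h) • e' + (T (P h) : F)
  have U_add : ∀ x y, U (x + y) = U x + U y := by
    intro x y
    simp only [U, P_add, T_add, inner_add_right, map_add, add_smul, Submodule.coe_add]
    abel
  have U_smul : ∀ (c : ℂ) x, U (c • x) = σ c • U x := by
    intro c x
    simp only [U, P_smul, T_smul, inner_smul_right, map_mul, smul_add, smul_smul,
      Submodule.coe_smul]
  have U_inner : ∀ x y, inner ℂ (U x) (U y) = σ (inner ℂ x y) := by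
    intro x y
    have h1 := inner_smul_add_smul_add (σ (inner ℂ e x)) (σ (inner ℂ e y)) hee' (mem' (T (P x)))
      (mem' (T (P y)))
    have h2 := inner_smul_add_smul_add (inner ℂ e x) (inner ℂ e y) hee (mem (P x)) (mem (P y))
    rw [← P_spec, ← P_spec] at h2
    rw [h2, map_add, map_mul, σ_conj]
    exact h1.trans (congrArg _ (T_inner _ _))
  refine ⟨U, σ, hσ, ⟨?_, ?_⟩, U_add, U_smul, U_inner, ?_⟩
  · intro x y hxy
    have h1 : U (x - y) = 0 := by
      have := U_add (x - y) y
      rw [sub_add_cancel, hxy] at this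
      simpa using this
    have h2 := U_inner (x - y) (x - y)
    rw [h1, inner_zero_left] at h2
    have h3 := congrArg σ h2
    rw [σσ, map_zero] at h3
    exact sub_eq_zero.1 (inner_self_eq_zero.1 h3.symm)
  · intro k
    obtain ⟨x, hx⟩ := T_surj ⟨k - inner ℂ e' k • e', by
      rw [Submodule.mem_orthogonal_singleton_iff_inner_right, inner_sub_right, inner_smul_right,
        hee', mul_one, sub_self]⟩
    have h1 : inner ℂ e (σ (inner ℂ e' k) • e + (x : E)) = σ (inner ℂ e' k) := by
      rw [inner_add_right, inner_smul_right, hee, mem, mul_one, add_zero]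
    -- The `e`-coordinate uses that `σ` is its own inverse.
    refine ⟨σ (inner ℂ e' k) • e + x, ?_⟩
    have h2 : P (σ (inner ℂ e' k) • e + x) = x := Subtype.ext (by
      change _ - inner ℂ e _ • e = _
      rw [h1, add_sub_cancel_left])
    simp only [U, h1, h2, σσ, hx]
    exact add_sub_cancel _ _
  · intro h hh
    -- Either `h` lies at infinity and `R_T` applies, or it is a multiple of a chart vector.
    by_cases hc : inner ℂ e h = 0
    · have h1 : (P h : E) = h := by
        conv_rhs => rw [P_spec h, hc, zero_smul, zero_add]
      have h2 : U h = T (P h) := by simp only [U, hc, map_zero, zero_smul, zero_add]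
      have h3 := R_T (P h) (by intro h0; rw [h0] at h1; exact hh h1.symm)
      rwa [h1, ← h2] at h3
    · set c := inner ℂ e h with hcdef
      have h1 := hR.smul (hTR (c⁻¹ • P h)) hc ((map_ne_zero σ).2 hc)
      have h2 : c • (e + ((c⁻¹ • P h : (ℂ ∙ e)ᗮ) : E)) = h := by
        rw [Submodule.coe_smul, smul_add, smul_smul, mul_inv_cancel₀ hc, one_smul]
        exact (P_spec h).symm
      have h3 : σ c • (e' + ((T (c⁻¹ • P h) : (ℂ ∙ e')ᗮ) : F)) = U h := by
        rw [T_smul, Submodule.coe_smul, smul_add, smul_smul, ← map_mul, mul_inv_cancel₀ hc,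
          map_one, one_smul]
      rwa [h2, h3] at h1

end OrthoCorrespondence

end OrthoCorrespondence

/-! ### Orthogonality of rays from the values 0 and 1 of a Chu morphism. -/

section Ray

variable {E : Type u} [NormedAddCommGroup E] [InnerProductSpace ℂ E]

/-- In dimension greater than two, two vectors have a common nonzero orthogonal vector. -/
theorem exists_ne_zero_inner_eq_zero (hE : 2 < Module.rank ℂ E) (x y : E) :
    ∃ z ≠ 0, inner ℂ x z = 0 ∧ inner ℂ y z = 0 := by
  have : FiniteDimensional ℂ (Submodule.span ℂ {x, y}) :=
    FiniteDimensional.span_of_finite ℂ (by simp)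
  have hne : (Submodule.span ℂ {x, y})ᗮ ≠ ⊥ := by
    rw [Ne, Submodule.orthogonal_eq_bot_iff]
    intro h
    have h1 := rank_span_le (R := ℂ) ({x, y} : Set E)
    rw [h, rank_top] at h1
    have h2 : Cardinal.mk ({x, y} : Set E) ≤ 2 := by
      refine (Cardinal.mk_insert_le).trans ?_
      rw [Cardinal.mk_singleton, one_add_one_eq_two]
    exact absurd (h1.trans h2) (not_le.2 hE)
  obtain ⟨z, hz, hz0⟩ := Submodule.exists_mem_ne_zero_of_ne_bot hne
  exact ⟨z, hz0, Submodule.inner_right_of_mem_orthogonal (Submodule.subset_span (by simp)) hz,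
    Submodule.inner_right_of_mem_orthogonal (Submodule.subset_span (by simp)) hz⟩

variable [CompleteSpace E]

theorem rayProb_mk_eq_zero_iff (ψ : E) (hψ : ψ ≠ 0) (S : ClosedSubmodule ℂ E) :
    rayProb (Projectivization.mk ℂ ψ hψ) S = 0 ↔ ψ ∈ S.toSubmoduleᗮ := by
  have h0 : ‖ψ‖ ≠ 0 := norm_ne_zero_iff.2 hψ
  rw [← Subtype.coe_inj]
  change ‖S.toSubmodule.starProjection ψ‖ ^ 2 / ‖ψ‖ ^ 2 = 0 ↔ _
  rw [div_eq_zero_iff, or_iff_left (pow_ne_zero 2 h0), pow_eq_zero_iff two_ne_zero,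
    norm_eq_zero, Submodule.starProjection_apply_eq_zero_iff]

/-- A vector spans a closed subspace. -/
def closedSpan (ψ : E) : ClosedSubmodule ℂ E :=
  ⟨ℂ ∙ ψ, Submodule.closed_of_finiteDimensional _⟩

theorem rayProb_closedSpan_eq_one_iff (p : ℙ ℂ E) (ψ : E) (hψ : ψ ≠ 0) :
    rayProb p (closedSpan ψ) = 1 ↔ p = Projectivization.mk ℂ ψ hψ := by
  induction p using Projectivization.ind with | h φ hφ =>
  rw [rayProb_mk_eq_one_iff, Projectivization.mk_eq_mk_iff']
  exact Submodule.mem_span_singleton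

theorem rayProb_closedSpan_eq_zero_iff (φ : E) (hφ : φ ≠ 0) (ψ : E) :
    rayProb (Projectivization.mk ℂ φ hφ) (closedSpan ψ) = 0 ↔ inner ℂ φ ψ = 0 := by
  rw [rayProb_mk_eq_zero_iff]
  exact Submodule.mem_orthogonal_singleton_iff_inner_left

theorem eq_of_rayProb_eq_one_iff {S T : ClosedSubmodule ℂ E}
    (h : ∀ p, rayProb p S = 1 ↔ rayProb p T = 1) : S = T := by
  refine SetLike.ext (A := ClosedSubmodule ℂ E) fun ψ => ?_
  by_cases hψ : ψ = 0
  · subst hψ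
    exact ⟨fun _ => zero_mem T, fun _ => zero_mem S⟩
  · rw [← rayProb_mk_eq_one_iff ψ hψ, ← rayProb_mk_eq_one_iff ψ hψ, h]

variable {F : Type u} [NormedAddCommGroup F] [InnerProductSpace ℂ F] [CompleteSpace F]

/-- A map of rays with a Chu adjoint on closed subspaces, with respect to the possibilistic
evaluations, is surjective. -/
theorem surjective_of_adjoint [Nontrivial E] {f : ℙ ℂ E → ℙ ℂ F}
    {g : ClosedSubmodule ℂ F → ClosedSubmodule ℂ E}
    (h0 : ∀ p S, rayProb p (g S) = 0 ↔ rayProb (f p) S = 0)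
    (h1 : ∀ p S, rayProb p (g S) = 1 ↔ rayProb (f p) S = 1) : Function.Surjective f := by
  -- a ray outside the range is orthogonal to the range
  have key : ∀ (ψ : F) (hψ : ψ ≠ 0), (∀ p, f p ≠ Projectivization.mk ℂ ψ hψ) →
      ∀ p, rayProb (f p) (closedSpan ψ) = 0 := by
    intro ψ hψ h p
    rw [← h0]
    induction p using Projectivization.ind with | h φ hφ =>
    rw [rayProb_mk_eq_zero_iff]
    -- The subspace `g (closedSpan ψ)` is zero: the ray of a nonzero vector in it would be mapped to
    -- the ray of `ψ`.
    intro x hx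
    have hx0 : x = 0 := by
      by_contra hx0
      exact h _ ((rayProb_closedSpan_eq_one_iff _ ψ hψ).1
        ((h1 _ _).1 ((rayProb_mk_eq_one_iff x hx0 _).2 hx)))
    rw [hx0, inner_zero_left]
  intro q
  by_contra hq
  push Not at hq
  induction q using Projectivization.ind with | h ψ hψ =>
  obtain ⟨φ, hφ⟩ := exists_ne (0 : E)
  have hp := key ψ hψ hq (Projectivization.mk ℂ φ hφ)
  obtain ⟨χ, hχ, hfχ⟩ : ∃ (χ : F) (hχ : χ ≠ 0),
      f (Projectivization.mk ℂ φ hφ) = Projectivization.mk ℂ χ hχ :=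
    ⟨_, Projectivization.rep_nonzero _, (Projectivization.mk_rep _).symm⟩
  rw [hfχ, rayProb_closedSpan_eq_zero_iff] at hp
  -- With `χ` in the range and `ψ` outside, `χ + ψ` cannot be outside, as it is not orthogonal to
  -- `χ`, nor in the range, as it is not orthogonal to `ψ`.
  have hne : inner ℂ χ (χ + ψ) ≠ 0 := by
    rw [inner_add_right, hp, add_zero]
    exact inner_self_ne_zero' hχ
  have hsum : χ + ψ ≠ 0 := fun h => hne (by rw [h, inner_zero_right])
  by_cases h : ∀ p, f p ≠ Projectivization.mk ℂ (χ + ψ) hsum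
  · have := key _ hsum h (Projectivization.mk ℂ φ hφ)
    rw [hfχ, rayProb_closedSpan_eq_zero_iff] at this
    exact hne this
  · push Not at h
    obtain ⟨p, hp'⟩ := h
    have := key ψ hψ hq p
    rw [hp', rayProb_closedSpan_eq_zero_iff, inner_add_left, hp, zero_add] at this
    exact inner_self_ne_zero' hψ this

/-- A map of rays with a Chu adjoint on closed subspaces preserves and reflects orthogonality. -/
theorem orthoCorrespondence_of_adjoint [Nontrivial E] {f : ℙ ℂ E → ℙ ℂ F}
    (hf : Function.Injective f) {g : ClosedSubmodule ℂ F → ClosedSubmodule ℂ E}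
    (h0 : ∀ p S, rayProb p (g S) = 0 ↔ rayProb (f p) S = 0)
    (h1 : ∀ p S, rayProb p (g S) = 1 ↔ rayProb (f p) S = 1) :
    OrthoCorrespondence fun (x : E) (x' : F) => ∃ (hx : x ≠ 0) (hx' : x' ≠ 0),
      f (Projectivization.mk ℂ x hx) = Projectivization.mk ℂ x' hx' where
  ne_zero := fun ⟨_, h, _⟩ => h
  total := fun {x} hx =>
    ⟨_, hx, Projectivization.rep_nonzero (f (Projectivization.mk ℂ x hx)),
      (Projectivization.mk_rep _).symm⟩
  surj := fun {x'} hx' => by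
    obtain ⟨p, hp⟩ := surjective_of_adjoint h0 h1 (Projectivization.mk ℂ x' hx')
    exact ⟨p.rep, p.rep_nonzero, hx', by rw [Projectivization.mk_rep, hp]⟩
  smul := by
    rintro x x' a b ⟨hx, hx', h⟩ ha hb
    refine ⟨smul_ne_zero ha hx, smul_ne_zero hb hx', ?_⟩
    rw [(Projectivization.mk_eq_mk_iff' ℂ (a • x) x (smul_ne_zero ha hx) hx).2 ⟨a, rfl⟩, h]
    exact ((Projectivization.mk_eq_mk_iff' ℂ (b • x') x' _ _).2 ⟨b, rfl⟩).symm
  inner_eq_zero_iff := by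
    rintro x x' y y' ⟨hx, hx', h⟩ ⟨hy, hy', k⟩
    -- Injectivity of `f` makes the ray of `y` the only one in `g (closedSpan y')`.
    have hg : g (closedSpan y') = closedSpan y := eq_of_rayProb_eq_one_iff fun p => by
      rw [h1, rayProb_closedSpan_eq_one_iff _ _ hy', rayProb_closedSpan_eq_one_iff _ _ hy, ← k,
        hf.eq_iff]
    rw [← rayProb_closedSpan_eq_zero_iff x hx, ← hg, h0, h, rayProb_closedSpan_eq_zero_iff]

end Ray

/-! ### Uniqueness up to phase, and the theorem. -/

/-- Semiunitaries that induce the same map on rays differ by a phase. -/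
theorem Semiunitary.phaseRel_of_mapRay_eq {H K : SymmH.{u}} (U V : Semiunitary H K)
    (h : U.mapRay = V.mapRay) : phaseRel (show H ⟶ K from U) V := by
  have hE := exists_ne_zero_inner_eq_zero H.two_lt_rank
  have hpt : ∀ x, x ≠ 0 → ∃ a : ℂ, U.toFun x = a • V.toFun x := by
    intro x hx
    obtain ⟨a, ha⟩ := (Projectivization.mk_eq_mk_iff' ℂ (U.toFun x) (V.toFun x)
      (U.map_ne_zero hx) (V.map_ne_zero hx)).1 (congrFun h (Projectivization.mk ℂ x hx))
    exact ⟨a, ha.symm⟩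
  have V_orth : ∀ {x y}, inner ℂ x y = 0 → inner ℂ (V.toFun x) (V.toFun y) = 0 := by
    intro x y hxy
    obtain ⟨σ, -, -, hi⟩ := V.semi
    rw [hi, hxy, _root_.map_zero]
  -- orthogonal vectors have the same phase
  have step : ∀ {x y : H.carrier} {a : ℂ}, x ≠ 0 → U.toFun x = a • V.toFun x →
      inner ℂ x y = 0 → U.toFun y = a • V.toFun y := by
    intro x y a hx ha hxy
    by_cases hy : y = 0
    · rw [hy, U.map_zero, V.map_zero, smul_zero]
    obtain ⟨b, hb⟩ := hpt y hy
    have hsum : x + y ≠ 0 := fun hs => inner_self_ne_zero' hx (by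
      have := congrArg (inner ℂ x) hs
      rwa [inner_add_right, hxy, add_zero, inner_zero_right] at this)
    -- Pairing with `V x` and `V y` shows that the scalars at `x` and `y` both equal the one at `x +
    -- y`.
    obtain ⟨c, hc⟩ := hpt (x + y) hsum
    rw [U.map_add, V.map_add, ha, hb, smul_add] at hc
    have e1 := congrArg (inner ℂ (V.toFun x)) hc
    have e2 := congrArg (inner ℂ (V.toFun y)) hc
    simp only [inner_add_right, inner_smul_right, V_orth hxy, V_orth (inner_eq_zero_symm.1 hxy),
      mul_zero, add_zero, zero_add] at e1 e2
    have hac := mul_right_cancel₀ (inner_self_ne_zero' (V.map_ne_zero hx)) e1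
    have hbc := mul_right_cancel₀ (inner_self_ne_zero' (V.map_ne_zero hy)) e2
    rw [hb, hbc, ← hac]
  obtain ⟨e, he, -⟩ := hE 0 0
  obtain ⟨z, hz, hez, -⟩ := hE e e
  obtain ⟨a, ha⟩ := hpt e he
  refine ⟨a, ?_, fun x => ?_⟩
  · have hn := congrArg norm ha
    rw [norm_smul, U.norm_map, V.norm_map] at hn
    exact (mul_eq_right₀ (norm_ne_zero_iff.2 he)).1 hn.symm
  · obtain ⟨c, y, rfl, hy⟩ := exists_eq_smul_add he x
    have e1 := step he ha hy
    -- The scalar passes from `e` to `z ⊥ e` and back to `c • e`, so `U` and `V` need not be known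
    -- to be both unitary or both antiunitary.
    have e2 : U.toFun (c • e) = a • V.toFun (c • e) := step hz (step he ha hez)
      (by rw [inner_smul_right, inner_eq_zero_symm.1 hez, mul_zero])
    change U.toFun _ = a • V.toFun _
    rw [U.map_add, V.map_add, e1, e2, smul_add]

theorem threeValued_eq_iff {s t : unitInterval} (h : threeValued s = threeValued t) :
    (s = 0 ↔ t = 0) ∧ (s = 1 ↔ t = 1) := by
  unfold threeValued at h
  split_ifs at h <;> simp_all

end QuantumChu

open QuantumChu

theorem theorem4 :
    QuantumChu.threeRep.{u}.Full ∧ QuantumChu.threeRep.{u}.Faithful := by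
  refine ⟨⟨?_⟩, ⟨?_⟩⟩
  · rintro ⟨H⟩ ⟨K⟩ ⟨f, hf⟩
    have hadj : ∀ (p : ℙ ℂ H.carrier) (S : ClosedSubmodule ℂ K.carrier),
        threeValued (rayProb p (f.bwd S)) = threeValued (rayProb (f.fwd p) S) := f.adj
    have h0 := fun p S => (threeValued_eq_iff (hadj p S)).1
    have h1 := fun p S => (threeValued_eq_iff (hadj p S)).2
    have hE := exists_ne_zero_inner_eq_zero H.two_lt_rank
    obtain ⟨e, he, -⟩ := hE 0 0
    have : Nontrivial H.carrier := ⟨e, 0, he⟩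
    obtain ⟨U, σ, hσ, hbij, hadd, hsmul, hinner, hU⟩ :=
      (orthoCorrespondence_of_adjoint hf h0 h1).exists_semiunitary hE
    let V : Semiunitary H K := ⟨U, hbij, hadd, σ, hσ, hsmul, hinner⟩
    have hV : V.mapRay = f.fwd := by
      funext p
      induction p using Projectivization.ind with | h φ hφ =>
      obtain ⟨_, _, h⟩ := hU φ hφ
      exact h.symm
    -- A closed subspace is determined by its rays, so adjointness at value 1 fixes the backward
    -- map.
    have hbwd : ∀ S : ClosedSubmodule ℂ K.carrier, V.preimage S = f.bwd S := fun S =>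
      eq_of_rayProb_eq_one_iff fun p => by
        rw [V.rayProb_preimage, hV]
        exact (h1 p S).symm
    refine ⟨(CategoryTheory.Quotient.functor phaseRel).map (show H ⟶ K from V), ?_⟩
    refine BmChuHom.ext (ChuHom.ext hV (funext hbwd))
  · rintro ⟨H⟩ ⟨K⟩ F G h
    induction F using Quot.ind with | mk U =>
    induction G using Quot.ind with | mk V =>
    exact CategoryTheory.Quotient.sound phaseRel (Semiunitary.phaseRel_of_mapRay_eq U V
      (congrArg (fun m => m.hom.fwd) h))
end
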